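/- **Setting.** Consider a network with base stations $n\in\mathcal N=\{0,1,\dots,N\}$ (station $0$ is the macro base station, the stations in $\mathcal N^+=\{1,\dots,N\}$ are small base stations) and contents $m\in\mathcal M=\{1,\dots,M\}$. Station $n$ caches the contents in $\mathcal M_n\subseteq\mathcal M$, and $\mathcal M_0=\mathcal M$. For each $n\in\mathcal N$ and $m\in\mathcal M_n$ there is a request queue of length $Q_{n,m}\in\{0,1,\dots,N_{n,m}\}$ with $N_{n,m}$ a finite non-negative integer; let $\boldsymbol{\mathcal Q}=\prod_{n\in\mathcal N}\prod_{m\in\mathcal M_n}\{0,\dots,N_{n,m}\}$ be the set of queue states. Let $\boldsymbol{\mathcal U}$ be the set of actions $\mathbf u=(u_n)_{n\in\mathcal N}$ with $u_n\in\mathcal M_n\cup\{0\}$ for all $n$ (where $u_n=0$ means that station $n$ is idle) and $u_0\sum_{n\in\mathcal N^+}u_n=0$. Let $p(n,m)\in\mathbb R$ for $n\in\mathcal N$, $m\in\mathcal M_n$ (transmission powers), $p(n,0)=0$, and $w\in\mathbb R$, and define the per-stage cost $$g(\mathbf Q,\mathbf u)=\sum_{n\in\mathcal N}\sum_{m\in\mathcal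 M_n}Q_{n,m}+w\sum_{n\in\mathcal N}p(n,u_n).$$ Let $\mathbf A=(A_{n,m})_{n\in\mathcal N,m\in\mathcal M}$ be a random matrix of non-negative integers (the request arrivals in one slot), with an arbitrary distribution; in particular its entries may be mutually independent. Given $\mathbf Q$ and $\mathbf u$, the next state $\mathbf Q'$ is $$Q'_{0,m}=\min\Big\{\mathbf 1(u_0\ne m)\,Q_{0,m}+A_{0,m}+\sum_{n\in\mathcal N^+:\,m\notin\mathcal M_n}A_{n,m},\;N_{0,m}\Big\},\quad m\in\mathcal M_0,$$ $$Q'_{n,m}=\min\big\{\mathbf 1(u_0\ne m\text{ and }u_n\ne m)\,Q_{n,m}+A_{n,m},\;N_{n,m}\big\},\quad n\in\mathcal N^+,\ m\in\mathcal M_n.$$ **Lemma (Monotonicity of $V(\mathbf Q)$).** Let $\theta\in\mathbb R$ and $V:\boldsymbol{\mathcal Q}\to\mathbb R$ satisfy the average-cost Bellman equation $$\theta+V(\mathbf Q)=\min_{\mathbf u\in\boldsymbol{\mathcal U}}\big\{g(\mathbf Q,\mathbf u)+\mathbb E[V(\mathbf Q')]\big\}\qquad\text{for all }\mathbf Q\in\boldsymbol{\mathcal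 Q},$$ where the expectation is over the distribution of $\mathbf A$. Then for all $\mathbf Q^1,\mathbf Q^2\in\boldsymbol{\mathcal Q}$ such that $Q^2_{n,m}\ge Q^1_{n,m}$ for all $n\in\mathcal N$, $m\in\mathcal M_n$, we have $V(\mathbf Q^2)\ge V(\mathbf Q^1)$. -/

import Mathlib

open MeasureTheory

/-- A cache-enabled heterogeneous network with `N` small base stations (SBSs) and `M` contents.
Base stations are indexed by `Fin (N + 1)`, index `0` being the macro base station (MBS). -/
structure HetNet (N M : ℕ) where
  /-- The set of contents cached at each base station. -/
  cache : Fin (N + 1) → Finset (Fin M)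
  /-- The MBS stores all contents. -/
  cache_zero : cache 0 = Finset.univ
  /-- The finite upper limit of the counter of queue `(n, m)`. -/
  cap : (n : Fin (N + 1)) → {m : Fin M // m ∈ cache n} → ℕ
  /-- The transmission power needed by base station `n` to multicast its cached content `m`. -/
  power : (n : Fin (N + 1)) → {m : Fin M // m ∈ cache n} → ℝ

namespace HetNet

variable {N M : ℕ}

/-- Request queue states: one queue for each base station `n` and each content `m` cached at `n`,
with length in `{0, …, cap n m}`. -/
abbrev State (S : HetNet N M) : Type :=
  (n : Fin (N + 1)) → (m : {m : Fin M // m ∈ S.cache n}) → Fin (S.cap n m + 1)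

/-- A feasible multicast scheduling action: each base station is idle (`none`) or multicasts one of
its cached contents, and the MBS and the SBSs do not operate concurrently. -/
structure Action (S : HetNet N M) where
  /-- The content scheduled at each base station, `none` meaning idle. -/
  sched : Fin (N + 1) → Option (Fin M)
  mem_cache : ∀ n m, sched n = some m → m ∈ S.cache n
  exclusive : sched 0 = none ∨ ∀ n, n ≠ 0 → sched n = none

/-- The power used by base station `n`: zero when idle. -/
noncomputable def stationPower (S : HetNet N M) (u : S.Action) (n : Fin (N + 1)) : ℝ :=
  match h : u.sched n with
  | none => 0
  | some m => S.power n ⟨m, u.mem_cache n m h⟩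

/-- The network power cost of an action. -/
noncomputable def powerCost (S : HetNet N M) (u : S.Action) : ℝ :=
  ∑ n, S.stationPower u n

/-- The network delay cost of a state: the sum of all queue lengths. -/
noncomputable def delayCost (S : HetNet N M) (Q : S.State) : ℝ :=
  ∑ n, ∑ m, ((Q n m : ℕ) : ℝ)

/-- The per-stage network cost, with weight `w` on the power cost. -/
noncomputable def stageCost (S : HetNet N M) (w : ℝ) (Q : S.State) (u : S.Action) : ℝ :=
  S.delayCost Q + w * S.powerCost u

/-- The number of requests entering the MBS queue of content `m`, when `a n m` requests for `m`
arrive from the users attached to `n` (for `n = 0`: from the users covered by no SBS). These are the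
requests from the areas of the SBSs not caching `m` and from the users covered by no SBS. -/
def mbsArrival (S : HetNet N M) (a : Fin (N + 1) → Fin M → ℕ) (m : Fin M) : ℕ :=
  (∑ n with n ≠ 0 ∧ m ∉ S.cache n, a n m) + a 0 m

/-- The queue dynamics: the state at the next slot, given the state `Q`, the action `u` and the
arrivals `a` during the slot. -/
def next (S : HetNet N M) (Q : S.State) (u : S.Action) (a : Fin (N + 1) → Fin M → ℕ) : S.State :=
  fun n m =>
    ⟨min (if n = 0 then
            (if u.sched 0 ≠ some m.1 then (Q n m : ℕ) else 0) + S.mbsArrival a m.1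
          else
            (if u.sched 0 ≠ some m.1 ∧ u.sched n ≠ some m.1 then (Q n m : ℕ) else 0) + a n m.1)
        (S.cap n m),
      Nat.lt_succ_of_le (min_le_right _ _)⟩

/-- The state-action cost: the stage cost plus the expected value of `V` at the next state, where
`A` is the random matrix of request arrivals in a slot. -/
noncomputable def stateActionCost {Ω : Type*} [MeasurableSpace Ω] (S : HetNet N M) (P : Measure Ω)
    (A : Ω → Fin (N + 1) → Fin M → ℕ) (w : ℝ) (V : S.State → ℝ) (Q : S.State) (u : S.Action) : ℝ :=
  S.stageCost w Q u + ∫ ω, V (S.next Q u (A ω)) ∂P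

/-- The average-cost Bellman equation: at every state `Q`, the number `θ + V Q` is the minimum of
the state-action cost over all feasible actions. -/
def SolvesBellman {Ω : Type*} [MeasurableSpace Ω] (S : HetNet N M) (P : Measure Ω)
    (A : Ω → Fin (N + 1) → Fin M → ℕ) (w : ℝ) (θ : ℝ) (V : S.State → ℝ) : Prop :=
  ∀ Q : S.State,
    IsLeast (Set.range fun u : S.Action => S.stateActionCost P A w V Q u) (θ + V Q)

end HetNet

namespace HetNet

variable {N M : ℕ}

/-! An extremal argument on the Bellman equation itself, with no value iteration. Run two ordered
states under the same action and the same arrivals: the order survives (`next_mono`), so the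
expected future gap cannot exceed the largest gap over ordered pairs, while the delay cost is
strictly smaller at the lower state (`delayCost_strictMono`). The largest gap is therefore attained
only on the diagonal, where it is zero. -/

theorem next_mono (S : HetNet N M) (u : S.Action) (a : Fin (N + 1) → Fin M → ℕ) :
    Monotone fun Q : S.State => S.next Q u a := by
  intro Q₁ Q₂ hQ n m
  have h : (Q₁ n m : ℕ) ≤ Q₂ n m := hQ n m
  change (_ : ℕ) ≤ _
  simp only [next]
  refine min_le_min ?_ le_rfl
  -- The conditions depend on `u`, `n` and `m` but not on the state, so both sides take the same
  -- branch.
  split_ifs <;> omega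

theorem delayCost_strictMono (S : HetNet N M) : StrictMono S.delayCost := by
  intro Q₁ Q₂ hQ
  obtain ⟨hle, n, hn⟩ := Pi.lt_def.1 hQ
  obtain ⟨hnle, m, hm⟩ := Pi.lt_def.1 hn
  refine Finset.sum_lt_sum (fun k _ => Finset.sum_le_sum fun l _ => ?_)
    ⟨n, Finset.mem_univ n, Finset.sum_lt_sum (fun l _ => ?_) ⟨m, Finset.mem_univ m, ?_⟩⟩
  · exact Nat.cast_le.2 (Fin.val_fin_le.2 (hle k l))
  · exact Nat.cast_le.2 (Fin.val_fin_le.2 (hnle l))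
  · exact Nat.cast_lt.2 (Fin.val_fin_lt.2 hm)

/-- There are countably many arrival matrices, so measurability is automatic on that space; finitely
many states make `V` bounded. -/
theorem integrable_comp_next {Ω : Type*} [MeasurableSpace Ω] (S : HetNet N M) (P : Measure Ω)
    [IsFiniteMeasure P] {A : Ω → Fin (N + 1) → Fin M → ℕ}
    (hA : ∀ n m, Measurable fun ω => A ω n m) (V : S.State → ℝ) (Q : S.State) (u : S.Action) :
    Integrable (fun ω => V (S.next Q u (A ω))) P := by
  have hA' : Measurable A := measurable_pi_iff.2 fun n => measurable_pi_iff.2 fun m => hA n m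
  have hm : Measurable fun a : Fin (N + 1) → Fin M → ℕ => V (S.next Q u a) :=
    Measurable.of_discrete
  obtain ⟨C, hC⟩ := (Set.finite_range fun Q => ‖V Q‖).bddAbove
  exact Integrable.of_bound (hm.comp hA').aestronglyMeasurable C
    (Filter.Eventually.of_forall fun ω => hC ⟨_, rfl⟩)

/-- A pair `Q₁ ≤ Q₂` that maximizes `V Q₁ - V Q₂` has `Q₁ = Q₂`: otherwise, using the optimal action
of `Q₂` at `Q₁` as well strictly lowers the stage cost, while the expected difference at the next
slot is at most the maximum. -/
theorem SolvesBellman.monotone {Ω : Type*} [MeasurableSpace Ω] {S : HetNet N M} {P : Measure Ω}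
    [IsProbabilityMeasure P] {A : Ω → Fin (N + 1) → Fin M → ℕ}
    (hA : ∀ n m, Measurable fun ω => A ω n m) {w θ : ℝ} {V : S.State → ℝ}
    (hV : S.SolvesBellman P A w θ V) : Monotone V := by
  intro R₁ R₂ hR
  obtain ⟨⟨⟨Q₁, Q₂⟩, hQ⟩, hmax⟩ :=
    haveI : Nonempty {p : S.State × S.State // p.1 ≤ p.2} := ⟨⟨(R₁, R₂), hR⟩⟩
    Finite.exists_max fun p : {p : S.State × S.State // p.1 ≤ p.2} => V p.1.1 - V p.1.2
  have hbound : ∀ T₁ T₂ : S.State, T₁ ≤ T₂ → V T₁ - V T₂ ≤ V Q₁ - V Q₂ :=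
    fun T₁ T₂ hT => hmax ⟨(T₁, T₂), hT⟩
  rcases (show Q₁ ≤ Q₂ from hQ).eq_or_lt with rfl | hlt
  -- On the diagonal the maximal gap is `0`.
  · linarith [hbound R₁ R₂ hR]
  obtain ⟨u, hu⟩ := (hV Q₂).1
  have hle : θ + V Q₁ ≤ S.stateActionCost P A w V Q₁ u := (hV Q₁).2 ⟨u, rfl⟩
  have hnext : ∫ ω, (V (S.next Q₁ u (A ω)) - V (S.next Q₂ u (A ω))) ∂P ≤ V Q₁ - V Q₂ := by
    calc _ ≤ ∫ _, (V Q₁ - V Q₂) ∂P :=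
          integral_mono ((S.integrable_comp_next P hA V Q₁ u).sub
            (S.integrable_comp_next P hA V Q₂ u)) (integrable_const _)
            fun ω => hbound _ _ (S.next_mono u (A ω) hQ)
      _ = V Q₁ - V Q₂ := by simp
  rw [integral_sub (S.integrable_comp_next P hA V Q₁ u)
    (S.integrable_comp_next P hA V Q₂ u)] at hnext
  have hcost := S.delayCost_strictMono hlt
  simp only [stateActionCost, stageCost] at hu hle
  -- With the same `u` on both sides, `θ` and the power cost cancel whatever the sign of `w`,
  -- leaving the maximal gap strictly below itself.
  linarith

end HetNet

theorem lemma2 {N M : ℕ} (S : HetNet N M) {Ω : Type*} [MeasurableSpace Ω]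
    (P : Measure Ω) [IsProbabilityMeasure P]
    (A : Ω → Fin (N + 1) → Fin M → ℕ) (hA : ∀ n m, Measurable fun ω => A ω n m)
    (w θ : ℝ) (V : S.State → ℝ) (hV : S.SolvesBellman P A w θ V)
    (Q₁ Q₂ : S.State) (hQ : ∀ n m, Q₁ n m ≤ Q₂ n m) :
    V Q₁ ≤ V Q₂ :=
  hV.monotone hA hQ
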